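/- Let $\mathcal Q\subset\mathbb R^d$ be compact and let $\mathcal X$ be a random element of $L_2(\mathcal Q)$ (with respect to Lebesgue measure) with $\mathbb E\|\mathcal X\|^2<\infty$, mean $m=\mathbb E(\mathcal X)$ and covariance operator $\mathcal C=\mathbb E\{(\mathcal X-m)\otimes(\mathcal X-m)\}$, where $(g\otimes h)f=\langle f,h\rangle g$. Let $c\in L_2(\mathcal Q\times\mathcal Q)$ be the kernel of $\mathcal C$, i.e. $\mathcal Cf(u)=\int_{\mathcal Q}c(u,v)f(v)\,dv$ for a.e. $u \in \mathcal Q$ and all $f\in L_2(\mathcal Q)$. Let $\sigma:\mathbb R\to[0,1]$ be sigmoidal, i.e. non-decreasing with $\lim_{x\to\infty}\sigma(x)=1$ and $\lim_{x\to-\infty}\sigma(x)=0$ (not necessarily continuous). A deep network with $L>1$ hidden layers of widths $p_1,\dots,p_L\ge 1$ is a function $g(u)=\sigma(w^\top u_L+\beta)$ of $u\in\mathbb R^d$, where $u_0=u$, $p_0=d$, and $u_{l+1}=\sigma(W_{l+1}u_l+b_{l+1})$ for $l=0,\dots,L-1$, with $W_l\in\mathbb R^{p_l\times p_{l-1}}$,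 $b_l\in\mathbb R^{p_l}$, $w\in\mathbb R^{p_L}$, $\beta\in\mathbb R$, and $\sigma$ applied componentwise. A deep CovNet kernel is a function $$k(u,v)=\sum_{r=1}^R\sum_{s=1}^R\lambda_{r,s}\,g_r(u)\,g_s(v),$$ where $R\ge1$, the matrix $(\lambda_{r,s})$ is symmetric positive semi-definite, and $g_1,\dots,g_R$ are deep networks with common $L$ and $p_1,\dots,p_L$. It is a deepshared CovNet kernel if moreover $g_1,\dots,g_R$ have the same $W_1,b_1,\dots,W_L,b_L$ (so that only $w$ and $\beta$ depend on $r$). Then for every $\epsilon>0$ there are a deep CovNet kernel $c_{\rm d}$ and a deepshared CovNet kernel $c_{\rm ds}$ (whose $R$, $L$ and widths may differ) such that $$\int_{\mathcal Q\times\mathcal Q}|c(u,v)-c_{\rm d}(u,v)|^2\,du\,dv\le\epsilon\quad\text{and}\quad\int_{\mathcal Q\times\mathcal Q}|c(u,v)-c_{\rm ds}(u,v)|^2\,du\,dv\le\epsilon .$$ Suppose in addition that $c$ is continuous on $\mathcal Q\times\mathcal Q$, and that $c$ is symmetric and non-negative definite at all points of $\mathcal Q$ or that every non-empty relatively open subset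 of $\mathcal Q$ has positive Lebesgue measure. Then for every $\epsilon>0$ there are a deep CovNet kernel $c_{\rm d}$ and a deepshared CovNet kernel $c_{\rm ds}$ such that $$\sup_{u,v\in\mathcal Q}|c(u,v)-c_{\rm d}(u,v)|\le\epsilon\quad\text{and}\quad\sup_{u,v\in\mathcal Q}|c(u,v)-c_{\rm ds}(u,v)|\le\epsilon .$$ -/

import Mathlib

open MeasureTheory Filter Topology Matrix

noncomputable section

namespace CovNet

/-- A sigmoidal activation: a non-decreasing function with values in `[0, 1]`, limit `1` at `+∞`
and limit `0` at `-∞`. No continuity is required. -/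
structure Sigmoidal (σ : ℝ → ℝ) : Prop where
  mem_Icc : ∀ x, σ x ∈ Set.Icc (0 : ℝ) 1
  monotone : Monotone σ
  tendsto_atTop : Tendsto σ atTop (𝓝 1)
  tendsto_atBot : Tendsto σ atBot (𝓝 0)

/-- Number of nodes of the layers of a network on `ℝ^d`: layer `0` is the input, and
layer `l + 1` has `p l` nodes (so `p 0, …, p (L - 1)` are the widths of the `L` hidden layers
and the other entries of `p` are never used). -/
def layerWidth (d : ℕ) (p : ℕ → ℕ) : ℕ → ℕ
  | 0 => d
  | l + 1 => p l

/-- The output of layer `l` of a network with activation `σ`, weight matrices `W` and biases `b`,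
at the input `u`. -/
def layer (σ : ℝ → ℝ) {d : ℕ} {p : ℕ → ℕ}
    (W : (l : ℕ) → Matrix (Fin (layerWidth d p (l + 1))) (Fin (layerWidth d p l)) ℝ)
    (b : (l : ℕ) → Fin (layerWidth d p (l + 1)) → ℝ) (u : Fin d → ℝ) :
    (l : ℕ) → Fin (layerWidth d p l) → ℝ
  | 0 => u
  | l + 1 => fun i => σ ((W l *ᵥ layer σ W b u l) i + b l i)

/-- The class of deep neural networks `ℝ^d → ℝ` with activation `σ`, with `L` hidden layers of
widths `p 0, …, p (L - 1)`. The activation is also applied at the output node. -/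
def deepNets (σ : ℝ → ℝ) (d L : ℕ) (p : ℕ → ℕ) : Set ((Fin d → ℝ) → ℝ) :=
  {g | ∃ (W : (l : ℕ) → Matrix (Fin (layerWidth d p (l + 1))) (Fin (layerWidth d p l)) ℝ)
      (b : (l : ℕ) → Fin (layerWidth d p (l + 1)) → ℝ)
      (w : Fin (layerWidth d p L) → ℝ) (β : ℝ),
      g = fun u => σ (w ⬝ᵥ layer σ W b u L + β)}

/-- The families `g_1, …, g_R` of deep neural networks that share all the parameters of
their `L` hidden layers and differ in the output node only. -/
def sharedDeepNets (σ : ℝ → ℝ) (d R L : ℕ) (p : ℕ → ℕ) : Set (Fin R → (Fin d → ℝ) → ℝ) :=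
  {g | ∃ (W : (l : ℕ) → Matrix (Fin (layerWidth d p (l + 1))) (Fin (layerWidth d p l)) ℝ)
      (b : (l : ℕ) → Fin (layerWidth d p (l + 1)) → ℝ)
      (ω : Fin R → Fin (layerWidth d p L) → ℝ) (β : Fin R → ℝ),
      g = fun r u => σ (ω r ⬝ᵥ layer σ W b u L + β r)}

/-- The kernel `∑ r, ∑ s, Λ r s * g_r(u) * g_s(v)`. -/
def covNetKernel {d R : ℕ} (Λ : Matrix (Fin R) (Fin R) ℝ) (g : Fin R → (Fin d → ℝ) → ℝ)
    (u v : Fin d → ℝ) : ℝ :=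
  ∑ r, ∑ s, Λ r s * g r u * g s v

/-- The deep CovNet kernels with `R` components, depth `L` and widths `p`. -/
def deepKernels (σ : ℝ → ℝ) (d R L : ℕ) (p : ℕ → ℕ) : Set ((Fin d → ℝ) → (Fin d → ℝ) → ℝ) :=
  {k | ∃ (Λ : Matrix (Fin R) (Fin R) ℝ) (g : Fin R → (Fin d → ℝ) → ℝ),
      Λ.PosSemidef ∧ (∀ r, g r ∈ deepNets σ d L p) ∧ k = covNetKernel Λ g}

/-- The deepshared CovNet kernels with `R` components, depth `L` and widths `p`. -/
def deepsharedKernels (σ : ℝ → ℝ) (d R L : ℕ) (p : ℕ → ℕ) :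
    Set ((Fin d → ℝ) → (Fin d → ℝ) → ℝ) :=
  {k | ∃ (Λ : Matrix (Fin R) (Fin R) ℝ) (g : Fin R → (Fin d → ℝ) → ℝ),
      Λ.PosSemidef ∧ g ∈ sharedDeepNets σ d R L p ∧ k = covNetKernel Λ g}

/-- `k` is a deep CovNet kernel, for some number `R` of components, some depth `L > 1` and
some widths. -/
def IsDeepCovNet (σ : ℝ → ℝ) {d : ℕ} (k : (Fin d → ℝ) → (Fin d → ℝ) → ℝ) : Prop :=
  ∃ (R L : ℕ) (p : ℕ → ℕ), 0 < R ∧ 1 < L ∧ (∀ l < L, 0 < p l) ∧ k ∈ deepKernels σ d R L p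

/-- `k` is a deepshared CovNet kernel, for some number `R` of components, some depth `L > 1` and
some widths. -/
def IsDeepsharedCovNet (σ : ℝ → ℝ) {d : ℕ} (k : (Fin d → ℝ) → (Fin d → ℝ) → ℝ) : Prop :=
  ∃ (R L : ℕ) (p : ℕ → ℕ), 0 < R ∧ 1 < L ∧ (∀ l < L, 0 < p l) ∧ k ∈ deepsharedKernels σ d R L p

/-- The Hilbert space `L²(Q)` of real functions, for Lebesgue measure on `Q ⊆ ℝ^d`. -/
abbrev L2 {d : ℕ} (Q : Set (Fin d → ℝ)) : Type :=
  Lp ℝ 2 ((volume : Measure (Fin d → ℝ)).restrict Q)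

/-- The covariance operator `E[(X - m) ⊗ (X - m)]`, `m = E[X]`, of a random element `X` of a
Hilbert space; both expectations are Bochner integrals, and `x ⊗ y` is `f ↦ ⟨f, y⟩ x`. -/
def covOperator {H Ω : Type*} [NormedAddCommGroup H] [InnerProductSpace ℝ H]
    [MeasurableSpace Ω] (P : Measure Ω) (X : Ω → H) : H →L[ℝ] H :=
  ∫ ω, InnerProductSpace.rankOne ℝ (X ω - ∫ ω', X ω' ∂P) (X ω - ∫ ω', X ω' ∂P) ∂P

/-- `c ∈ L²(Q × Q)` is the kernel of the operator `C` on `L²(Q)`: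
`(C f)(u) = ∫_Q c(u, v) f(v) dv` for almost every `u ∈ Q`, for all `f ∈ L²(Q)`. -/
structure IsKernelOf {d : ℕ} (Q : Set (Fin d → ℝ)) (c : (Fin d → ℝ) → (Fin d → ℝ) → ℝ)
    (C : L2 Q →L[ℝ] L2 Q) : Prop where
  memLp : MemLp (fun z : (Fin d → ℝ) × (Fin d → ℝ) => c z.1 z.2) 2 (volume.restrict (Q ×ˢ Q))
  apply_ae : ∀ f : L2 Q, ∀ᵐ u ∂(volume.restrict Q), C f u = ∫ v in Q, c u v * f v

/-- `c` is (symmetric and) non-negative definite on `Q`, pointwise. -/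
def NonnegDefOn {d : ℕ} (Q : Set (Fin d → ℝ)) (c : (Fin d → ℝ) → (Fin d → ℝ) → ℝ) : Prop :=
  ∀ (n : ℕ) (x : Fin n → Fin d → ℝ), (∀ i, x i ∈ Q) →
    (Matrix.of fun i j => c (x i) (x j)).PosSemidef

/-- Every non-empty relatively open subset of `Q` has positive Lebesgue measure. -/
def HasFullSupport {d : ℕ} (Q : Set (Fin d → ℝ)) : Prop :=
  ∀ U : Set (Fin d → ℝ), IsOpen U → (Q ∩ U).Nonempty → 0 < volume (Q ∩ U)

/-- `∫_{Q × Q} |c(u, v) - k(u, v)|² du dv ≤ ε`, the integrand being integrable. -/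
def L2Close {d : ℕ} (Q : Set (Fin d → ℝ)) (c k : (Fin d → ℝ) → (Fin d → ℝ) → ℝ) (ε : ℝ) : Prop :=
  IntegrableOn (fun z : (Fin d → ℝ) × (Fin d → ℝ) => |c z.1 z.2 - k z.1 z.2| ^ 2) (Q ×ˢ Q) ∧
    ∫ z in Q ×ˢ Q, |c z.1 z.2 - k z.1 z.2| ^ 2 ≤ ε

/-- `sup_{u, v ∈ Q} |c(u, v) - k(u, v)| ≤ ε`. -/
def UniformlyClose {d : ℕ} (Q : Set (Fin d → ℝ)) (c k : (Fin d → ℝ) → (Fin d → ℝ) → ℝ)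
    (ε : ℝ) : Prop :=
  ∀ u ∈ Q, ∀ v ∈ Q, |c u v - k u v| ≤ ε

end CovNet

end

noncomputable section

namespace CovNet

/-! Steep translates of a sigmoid approximate every continuous monotone function on an interval
(`Sigmoidal.unifApprox_of_monotone`). For the exponential this yields the functions exp (a · x),
whose span is an algebra separating points, so Stone–Weierstrass gives every continuous function on
a compact set (`Sigmoidal.unifApprox_id`). For the identity it lets a further layer reproduce linear
functionals of the layer below, so depth costs an arbitrarily small error and finitely many
functions can share their hidden layers (`Sigmoidal.exists_sharedDeepNets`). Putting such networks
into a kernel ∑ N i j ψ i (u) ψ j (v) conjugates N, which keeps it positive semi-definite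
(`Sigmoidal.exists_deepshared`).

It remains to approximate c by kernels of this form with N positive semi-definite. In the uniform
case c is sampled on a fine net and interpolated by a partition of unity (`exists_sampling`); the
coefficients c (x i) (x j) form a positive semi-definite matrix by non-negative definiteness, which
under full support follows by averaging over small balls. In L² point values mean nothing: c is
replaced by a continuous g, and sampling g may give indefinite coefficients. The orthogonal
projection of c onto the span of the ψ k ⊗ ψ l is at least as close, and its coefficients can be
taken positive semi-definite because the covariance operator is non-negative
(`exists_posSemidef_norm_sub_le`). A deepshared kernel is a deep one, so a single construction
serves both claims. -/

/-- `f` is a uniform limit on `Q` of functions of `V`. -/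
def UnifApprox {E : Type*} (Q : Set E) (V : Submodule ℝ (E → ℝ)) (f : E → ℝ) : Prop :=
  ∀ ε : ℝ, 0 < ε → ∃ g ∈ V, ∀ u ∈ Q, |f u - g u| ≤ ε

theorem UnifApprox.add {E : Type*} {Q : Set E} {V : Submodule ℝ (E → ℝ)} {f f' : E → ℝ}
    (hf : UnifApprox Q V f) (hf' : UnifApprox Q V f') : UnifApprox Q V (f + f') := by
  intro ε hε
  obtain ⟨g, hg, h⟩ := hf (ε / 2) (half_pos hε)
  obtain ⟨g', hg', h'⟩ := hf' (ε / 2) (half_pos hε)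
  refine ⟨g + g', V.add_mem hg hg', fun u hu => ?_⟩
  have h1 := abs_le.1 (h u hu)
  have h2 := abs_le.1 (h' u hu)
  simp only [Pi.add_apply]
  exact abs_le.2 ⟨by linarith [h1.1, h2.1], by linarith [h1.2, h2.2]⟩

theorem UnifApprox.smul {E : Type*} {Q : Set E} {V : Submodule ℝ (E → ℝ)} {f : E → ℝ}
    (a : ℝ) (hf : UnifApprox Q V f) : UnifApprox Q V (a • f) := by
  intro ε hε
  obtain ⟨g, hg, h⟩ := hf (ε / (|a| + 1)) (by positivity)
  refine ⟨a • g, V.smul_mem a hg, fun u hu => ?_⟩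
  have h1 := h u hu
  rw [le_div_iff₀ (by positivity)] at h1
  simp only [Pi.smul_apply, smul_eq_mul]
  rw [← mul_sub, abs_mul]
  nlinarith [abs_nonneg a, abs_nonneg (f u - g u)]

theorem UnifApprox.zero {E : Type*} {Q : Set E} {V : Submodule ℝ (E → ℝ)} :
    UnifApprox Q V 0 :=
  fun ε hε => ⟨0, V.zero_mem, fun u _ => by simpa using hε.le⟩

/-! ### Superpositions of a sigmoid on the line -/

/-- The span of the functions `x ↦ σ (s x + t)` of one real variable. -/
def affineSpan1 (σ : ℝ → ℝ) : Submodule ℝ (ℝ → ℝ) :=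
  Submodule.span ℝ (Set.range fun (p : ℝ × ℝ) (x : ℝ) => σ (p.1 * x + p.2))

theorem Sigmoidal.const_mem_affineSpan1 {σ : ℝ → ℝ} (hσ : Sigmoidal σ) (a : ℝ) :
    (fun _ => a) ∈ affineSpan1 σ := by
  obtain ⟨t, ht⟩ : ∃ t, 0 < σ t :=
    (hσ.tendsto_atTop.eventually (lt_mem_nhds one_pos)).exists
  have h1 : (fun x : ℝ => σ (0 * x + t)) ∈ affineSpan1 σ :=
    Submodule.subset_span ⟨(0, t), rfl⟩
  convert (affineSpan1 σ).smul_mem (a / σ t) h1 using 1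
  ext x
  simp [ht.ne']

theorem Sigmoidal.exists_threshold {σ : ℝ → ℝ} (hσ : Sigmoidal σ) {δ : ℝ} (hδ : 0 < δ) :
    ∃ M : ℝ, 0 < M ∧ (∀ x, M ≤ x → |1 - σ x| ≤ δ) ∧ ∀ x, x ≤ -M → |σ x| ≤ δ := by
  obtain ⟨M₁, h₁⟩ := eventually_atTop.1
    (hσ.tendsto_atTop.eventually (Metric.closedBall_mem_nhds 1 hδ))
  obtain ⟨M₂, h₂⟩ := eventually_atBot.1
    (hσ.tendsto_atBot.eventually (Metric.closedBall_mem_nhds 0 hδ))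
  refine ⟨max 1 (max M₁ (-M₂)), by positivity, fun x hx => ?_, fun x hx => ?_⟩
  · have := h₁ x (((le_max_left _ _).trans (le_max_right _ _)).trans hx)
    rwa [dist_comm, Real.dist_eq] at this
  · have h3 : -M₂ ≤ max 1 (max M₁ (-M₂)) := (le_max_right _ _).trans (le_max_right _ _)
    have := h₂ x (by linarith)
    rwa [Real.dist_eq, sub_zero] at this

/-- Every continuous non-decreasing function of one variable is, on a compact interval, a uniform
limit of linear combinations of the functions `x ↦ σ (s x + t)`. -/
theorem Sigmoidal.unifApprox_of_monotone {σ : ℝ → ℝ} (hσ : Sigmoidal σ) {φ : ℝ → ℝ}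
    (hφ : Continuous φ) (hm : Monotone φ) (a b : ℝ) (hab : a < b) :
    UnifApprox (Set.Icc a b) (affineSpan1 σ) φ := by
  intro ε hε
  obtain ⟨τ, hτ, hτε⟩ := Metric.uniformContinuousOn_iff.1
    (isCompact_Icc.uniformContinuousOn_of_continuous (s := Set.Icc a b) hφ.continuousOn)
    (ε / 2) (half_pos hε)
  obtain ⟨n, hn⟩ := exists_nat_gt ((b - a) / τ)
  have hn0 : (0 : ℝ) < n := (div_pos (sub_pos.2 hab) hτ).trans hn
  set η : ℝ := (b - a) / n with hη
  have hη0 : 0 < η := div_pos (sub_pos.2 hab) hn0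
  have hητ : η < τ := by
    rw [hη, div_lt_iff₀ hn0]; rw [div_lt_iff₀ hτ] at hn; linarith
  have hnη : n * η = b - a := by rw [hη]; field_simp
  let t : ℕ → ℝ := fun j => a + j * η
  have ht : ∀ j, t (j + 1) = t j + η := fun j => by simp only [t]; push_cast; ring
  have htn : t n = b := by simp only [t]; linarith
  have ht0 : t 0 = a := by simp [t]
  have htm : Monotone t := monotone_nat_of_le_succ fun j => by rw [ht]; linarith
  let D : ℝ := φ b - φ a
  have hD : 0 ≤ D := sub_nonneg.2 (hm hab.le)
  -- Errors off the cell of `x` are weighted by the increments of φ and total at most δ D; the `+ 1`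
  -- covers D = 0.
  let δ : ℝ := ε / (2 * (D + 1))
  have hδ : 0 < δ := by positivity
  have hδD : δ * D ≤ ε / 2 := by
    have : δ * (D + 1) = ε / 2 := by simp only [δ]; field_simp
    nlinarith
  obtain ⟨M, hM, hM1, hM2⟩ := hσ.exists_threshold hδ
  let A : ℝ := 2 * M / η
  have hA : A * (η / 2) = M := by simp only [A]; field_simp
  have hA0 : 0 < A := by positivity
  let h : ℕ → ℝ := fun j => φ (t (j + 1)) - φ (t j)
  have hh : ∀ j, 0 ≤ h j := fun j => sub_nonneg.2 (hm (htm j.le_succ))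
  have hhε : ∀ j < n, h j ≤ ε / 2 := fun j hj => by
    have h1 : ∀ i ≤ n, t i ∈ Set.Icc a b := fun i hi =>
      ⟨ht0 ▸ htm i.zero_le, htn ▸ htm hi⟩
    have h2 := hτε (t (j + 1)) (h1 _ hj) (t j) (h1 _ hj.le) (by
      rw [Real.dist_eq, ht, add_sub_cancel_left, abs_of_pos hη0]; exact hητ)
    rw [Real.dist_eq] at h2
    exact (le_abs_self _).trans h2.le
  -- A smoothed step centred at the midpoint of cell j. Since A η / 2 = M, it is δ-close to 0 to the
  -- left of the cell and to 1 to the right.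
  let s : ℕ → ℝ → ℝ := fun j x => σ (A * x + -(A * (t j + η / 2)))
  refine ⟨(fun _ => φ a) + ∑ j ∈ Finset.range n, h j • s j,
    Submodule.add_mem _ (hσ.const_mem_affineSpan1 _) (Submodule.sum_mem _ fun j _ =>
      Submodule.smul_mem _ _ (Submodule.subset_span ⟨(A, -(A * (t j + η / 2))), rfl⟩)), ?_⟩
  intro x hx
  -- The clipped increments equal `h j` for cells left of `x` and 0 for cells right of it, so they
  -- can be compared with `h j * s j x` term by term.
  have htel : φ x - φ a = ∑ j ∈ Finset.range n, (φ (min x (t (j + 1))) - φ (min x (t j))) := by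
    rw [Finset.sum_range_sub (fun j => φ (min x (t j))), htn, ht0, min_eq_left hx.2,
      min_eq_right hx.1]
  have hDs : ∑ j ∈ Finset.range n, h j = D := by
    simp only [h]
    rw [Finset.sum_range_sub (fun j => φ (t j)), htn, ht0]
  -- The cell containing `x`; at x = b it is n, outside the range, and then no exceptional term
  -- occurs.
  let k : ℕ := ⌊(x - a) / η⌋₊
  have hterm : ∀ j ∈ Finset.range n,
      |(φ (min x (t (j + 1))) - φ (min x (t j))) - h j * s j x| ≤
        δ * h j + if j = k then ε / 2 else 0 := by
    intro j hj
    have hjn := Finset.mem_range.1 hj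
    have harg : A * x + -(A * (t j + η / 2)) = A * (x - t j - η / 2) := by ring
    rcases lt_trichotomy j k with hjk | hjk | hjk
    · rw [if_neg hjk.ne, add_zero]
      have hle : t (j + 1) ≤ x := by
        have h1 : ((j + 1 : ℕ) : ℝ) ≤ (x - a) / η :=
          (Nat.le_floor_iff (div_nonneg (sub_nonneg.2 hx.1) hη0.le)).1 hjk
        rw [le_div_iff₀ hη0] at h1
        simp only [t]; linarith
      rw [min_eq_right hle, min_eq_right ((htm j.le_succ).trans hle)]
      change |h j - h j * s j x| ≤ _
      rw [show h j - h j * s j x = h j * (1 - s j x) by ring, abs_mul, abs_of_nonneg (hh j),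
        mul_comm]
      refine mul_le_mul_of_nonneg_right (hM1 _ ?_) (hh j)
      rw [harg, ← hA]
      rw [ht] at hle
      exact mul_le_mul_of_nonneg_left (by linarith) hA0.le
    · rw [if_pos hjk]
      -- In the cell of `x` both terms lie between 0 and `h j`, which is at most ε / 2.
      have h1 : φ (min x (t j)) ≤ φ (min x (t (j + 1))) :=
        hm (min_le_min le_rfl (htm j.le_succ))
      have h2 : φ (min x (t (j + 1))) - φ (min x (t j)) ≤ h j := by
        simp only [h]
        rcases le_total x (t j) with hxt | hxt
        · rw [min_eq_left hxt, min_eq_left (hxt.trans (htm j.le_succ)), sub_self]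
          exact hh j
        · rw [min_eq_right hxt]
          exact sub_le_sub_right (hm (min_le_right _ _)) _
      have h3 := hσ.mem_Icc (A * x + -(A * (t j + η / 2)))
      have h4 : 0 ≤ h j * s j x := mul_nonneg (hh j) h3.1
      have h5 : h j * s j x ≤ h j := mul_le_of_le_one_right (hh j) h3.2
      have h6 : 0 ≤ δ * h j := mul_nonneg hδ.le (hh j)
      have h7 := hhε j hjn
      exact abs_le.2 ⟨by linarith, by linarith⟩
    · rw [if_neg hjk.ne', add_zero]
      have hle : x ≤ t j := by
        have h1 : (x - a) / η < j := Nat.lt_of_floor_lt hjk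
        rw [div_lt_iff₀ hη0] at h1
        simp only [t]; linarith
      rw [min_eq_left hle, min_eq_left (hle.trans (htm j.le_succ)), sub_self, zero_sub, abs_neg,
        abs_mul, abs_of_nonneg (hh j), mul_comm]
      refine mul_le_mul_of_nonneg_right (hM2 _ ?_) (hh j)
      rw [harg, ← hA, ← mul_neg]
      exact mul_le_mul_of_nonneg_left (by linarith) hA0.le
  have hsum : φ x - ((fun _ => φ a) + ∑ j ∈ Finset.range n, h j • s j : ℝ → ℝ) x =
      ∑ j ∈ Finset.range n, ((φ (min x (t (j + 1))) - φ (min x (t j))) - h j * s j x) := by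
    rw [Finset.sum_sub_distrib, ← htel]
    simp [Finset.sum_apply]
    ring
  rw [hsum]
  refine (Finset.abs_sum_le_sum_abs _ _).trans ((Finset.sum_le_sum hterm).trans ?_)
  rw [Finset.sum_add_distrib, ← Finset.mul_sum, hDs, Finset.sum_ite_eq']
  split_ifs <;> linarith

/-! ### Ridge functions and density on compact sets -/

/-- The span of the functions `u ↦ σ (w ⬝ᵥ h u + β)`. -/
def ridgeSpan (σ : ℝ → ℝ) {E : Type*} {n : ℕ} (h : E → Fin n → ℝ) : Submodule ℝ (E → ℝ) :=
  Submodule.span ℝ (Set.range fun (p : (Fin n → ℝ) × ℝ) (u : E) => σ (p.1 ⬝ᵥ h u + p.2))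

/-- Composition with u ↦ w · h u maps σ (s x + t) to a ridge function of weight s w; the bound on w
· h u confines the argument to a compact interval, where the one-variable result applies. -/
theorem Sigmoidal.unifApprox_ridge {σ : ℝ → ℝ} (hσ : Sigmoidal σ) {φ : ℝ → ℝ}
    (hφ : Continuous φ) (hm : Monotone φ) {E : Type*} {Q : Set E} {n : ℕ} (h : E → Fin n → ℝ)
    (w : Fin n → ℝ) {M : ℝ} (hM : ∀ u ∈ Q, |w ⬝ᵥ h u| ≤ M) :
    UnifApprox Q (ridgeSpan σ h) fun u => φ (w ⬝ᵥ h u) := by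
  intro ε hε
  obtain ⟨g, hg, hgε⟩ := hσ.unifApprox_of_monotone hφ hm (-(|M| + 1)) (|M| + 1)
    (by linarith [abs_nonneg M]) ε hε
  refine ⟨fun u => g (w ⬝ᵥ h u), ?_, fun u hu => hgε _ ?_⟩
  · have hle : affineSpan1 σ ≤
        (ridgeSpan σ h).comap (LinearMap.funLeft ℝ ℝ fun u => w ⬝ᵥ h u) := by
      refine Submodule.span_le.2 ?_
      rintro _ ⟨p, rfl⟩
      refine Submodule.subset_span ⟨(p.1 • w, p.2), ?_⟩
      ext u
      simp [LinearMap.funLeft_apply, smul_dotProduct]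
    exact hle hg
  · have := hM u hu
    have h2 := le_abs_self M
    exact abs_le.1 (by linarith)

/-- The exponentials `x ↦ exp (a ⬝ᵥ x)`, multiplicative in `a`. -/
def expHom {d : ℕ} : Multiplicative (Fin d → ℝ) →* C(Fin d → ℝ, ℝ) where
  toFun a := ⟨fun x => Real.exp (a.toAdd ⬝ᵥ x), by
    unfold dotProduct; fun_prop⟩
  map_one' := by ext x; simp
  map_mul' a b := by ext x; simp [add_dotProduct, Real.exp_add]

/-- Linear combinations of ridge functions `u ↦ σ (w ⬝ᵥ u + β)` are uniformly dense in the
continuous functions on a compact set. -/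
theorem Sigmoidal.unifApprox_id {σ : ℝ → ℝ} (hσ : Sigmoidal σ) {d : ℕ} {Q : Set (Fin d → ℝ)}
    (hQ : IsCompact Q) {f : (Fin d → ℝ) → ℝ} (hf : Continuous f) :
    UnifApprox Q (ridgeSpan σ (id : (Fin d → ℝ) → Fin d → ℝ)) f := by
  have hexp : ∀ g ∈ Algebra.adjoin ℝ (Set.range (expHom (d := d))),
      UnifApprox Q (ridgeSpan σ (id : (Fin d → ℝ) → Fin d → ℝ)) g := by
    intro g hg
    -- The exponentials are closed under products, so the algebra they generate is merely their
    -- linear span.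
    rw [← Subalgebra.mem_toSubmodule, Algebra.adjoin_eq_span, ← MonoidHom.coe_mrange,
      Submonoid.closure_eq] at hg
    induction hg using Submodule.span_induction with
    | mem g hg =>
      obtain ⟨a, rfl⟩ := hg
      have hcont : ContinuousOn (fun u : Fin d → ℝ => a.toAdd ⬝ᵥ id u) Q := by
        unfold dotProduct; simp only [id]; fun_prop
      obtain ⟨M, hM⟩ := hQ.exists_bound_of_continuousOn hcont
      exact hσ.unifApprox_ridge Real.continuous_exp Real.exp_monotone id a.toAdd hM
    | zero => exact UnifApprox.zero
    | add g g' _ _ h h' => exact h.add h'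
    | smul a g _ h => exact h.smul a
  intro ε hε
  obtain ⟨g, hg, hgε⟩ :=
    ContinuousMap.exists_mem_subalgebra_near_continuous_of_isCompact_of_separatesPoints
      (A := Algebra.adjoin ℝ (Set.range (expHom (d := d)))) (by
        intro x y hxy
        obtain ⟨i, hi⟩ := Function.ne_iff.1 hxy
        refine ⟨expHom (Multiplicative.ofAdd (Pi.single i 1)),
          ⟨_, Algebra.subset_adjoin ⟨_, rfl⟩, rfl⟩, ?_⟩
        simpa [expHom] using hi) ⟨f, hf⟩ hQ (half_pos hε)
  obtain ⟨q, hq, hqε⟩ := hexp g hg (ε / 2) (half_pos hε)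
  refine ⟨q, hq, fun u hu => ?_⟩
  have h1 := hgε u hu
  have h2 := hqε u hu
  rw [Real.norm_eq_abs] at h1
  simp only [ContinuousMap.coe_mk] at h1
  rw [abs_sub_comm] at h1
  exact (abs_sub_le _ (g u) _).trans (by linarith)

/-! ### Shared deep networks and their kernels -/

/-- Finitely many elements of a span are combinations of one common finite family. -/
theorem exists_common_family {ι V : Type*} [Nonempty ι] [AddCommGroup V] [Module ℝ V] (φ : ι → V)
    {m : ℕ} (g : Fin m → V) (hg : ∀ i, g i ∈ Submodule.span ℝ (Set.range φ)) :
    ∃ (N : ℕ) (x : Fin (N + 1) → ι) (α : Fin m → Fin (N + 1) → ℝ),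
      ∀ i, g i = ∑ j, α i j • φ (x j) := by
  classical
  choose a ha using fun i => (Finsupp.mem_span_range_iff_exists_finsupp.1 (hg i))
  let i₀ : ι := Classical.arbitrary ι
  -- Inserting `i₀` keeps the family non-empty, hence the layer widths positive.
  let S : Finset ι := insert i₀ (Finset.univ.biUnion fun i => (a i).support)
  obtain ⟨N, hN⟩ : ∃ N, S.card = N + 1 :=
    Nat.exists_eq_succ_of_ne_zero (Finset.card_ne_zero_of_mem (Finset.mem_insert_self _ _))
  let e : Fin (N + 1) ≃ S := (S.equivFinOfCardEq hN).symm
  refine ⟨N, fun j => (e j : ι), fun i j => a i (e j), fun i => ?_⟩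
  rw [← ha i, e.sum_comp fun s : S => a i s • φ s, Finset.sum_coe_sort S fun s => a i s • φ s]
  refine Finsupp.sum_of_support_subset _ ?_ _ (by simp)
  exact (Finset.subset_biUnion_of_mem (fun i => (a i).support) (Finset.mem_univ i)).trans
    (Finset.subset_insert _ _)

/-- One layer of units on top of `h` approximates a finite family as well as functions in the
corresponding span do. -/
theorem exists_layer {σ : ℝ → ℝ} {E : Type*} {Q : Set E} {n m : ℕ} (h : E → Fin n → ℝ)
    (f : Fin m → E → ℝ) {δ : ℝ}
    (hf : ∀ i, ∃ g ∈ ridgeSpan σ h, ∀ u ∈ Q, |f i u - g u| ≤ δ) :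
    ∃ (N : ℕ) (W : Matrix (Fin (N + 1)) (Fin n) ℝ) (b : Fin (N + 1) → ℝ)
      (v : Fin m → Fin (N + 1) → ℝ),
      ∀ i, ∀ u ∈ Q, |f i u - v i ⬝ᵥ fun j => σ ((W *ᵥ h u) j + b j)| ≤ δ := by
  choose g hg hgδ using hf
  obtain ⟨N, x, α, hα⟩ := exists_common_family _ g hg
  refine ⟨N, Matrix.of fun j => (x j).1, fun j => (x j).2, α, fun i u hu => ?_⟩
  convert hgδ i u hu using 3
  rw [hα]
  simp [Finset.sum_apply, dotProduct, mulVec]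

/-- If `f` is close to a linear function of `h`, it is almost as close to the ridge span. -/
theorem Sigmoidal.exists_mem_ridgeSpan {σ : ℝ → ℝ} (hσ : Sigmoidal σ) {E : Type*} {Q : Set E}
    {n : ℕ} (h : E → Fin n → ℝ) (v : Fin n → ℝ) (f : E → ℝ) {B δ η : ℝ}
    (hB : ∀ u ∈ Q, |f u| ≤ B) (hf : ∀ u ∈ Q, |f u - v ⬝ᵥ h u| ≤ δ) (hη : 0 < η) :
    ∃ g ∈ ridgeSpan σ h, ∀ u ∈ Q, |f u - g u| ≤ δ + η := by
  obtain ⟨g, hg, hgη⟩ := hσ.unifApprox_ridge continuous_id monotone_id h v (M := B + δ)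
    (fun u hu => by
      have h1 := abs_sub_abs_le_abs_sub (v ⬝ᵥ h u) (f u)
      rw [abs_sub_comm] at h1
      linarith [hB u hu, hf u hu]) η hη
  exact ⟨g, hg, fun u hu => (abs_sub_le _ (v ⬝ᵥ h u) _).trans (add_le_add (hf u hu) (hgη u hu))⟩

/-- Finitely many continuous functions are uniformly approximated by linear combinations of
deep networks with two hidden layers that share their hidden layers. -/
theorem Sigmoidal.exists_sharedDeepNets {σ : ℝ → ℝ} (hσ : Sigmoidal σ) {d m : ℕ}
    {Q : Set (Fin d → ℝ)} (hQ : IsCompact Q) (f : Fin m → (Fin d → ℝ) → ℝ)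
    (hf : ∀ i, Continuous (f i)) {ε : ℝ} (hε : 0 < ε) :
    ∃ (R : ℕ) (p : ℕ → ℕ) (g : Fin (R + 1) → (Fin d → ℝ) → ℝ) (α : Fin m → Fin (R + 1) → ℝ),
      (∀ l, 0 < p l) ∧ g ∈ sharedDeepNets σ d (R + 1) 2 p ∧
      ∀ i, ∀ u ∈ Q, |f i u - ∑ r, α i r * g r u| ≤ ε := by
  have hε3 : 0 < ε / 3 := by positivity
  choose B hB using fun i => hQ.exists_bound_of_continuousOn (hf i).continuousOn
  obtain ⟨n₀, W₀, b₀, v₀, h₀⟩ := exists_layer (σ := σ) (Q := Q) id f fun i =>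
    hσ.unifApprox_id hQ (hf i) (ε / 3) hε3
  obtain ⟨n₁, W₁, b₁, v₁, h₁⟩ := exists_layer (σ := σ) (Q := Q) _ f fun i =>
    hσ.exists_mem_ridgeSpan _ (v₀ i) (f i) (hB i) (h₀ i) hε3
  -- The units of this third layer are the output nodes: σ acts on them too, and `α` recombines
  -- them.
  obtain ⟨R, ω, β, α, h₂⟩ := exists_layer (σ := σ) (Q := Q) _ f fun i =>
    hσ.exists_mem_ridgeSpan _ (v₁ i) (f i) (hB i) (h₁ i) hε3
  let p : ℕ → ℕ := fun l => match l with
    | 0 => n₀ + 1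
    | _ + 1 => n₁ + 1
  let W : (l : ℕ) → Matrix (Fin (layerWidth d p (l + 1))) (Fin (layerWidth d p l)) ℝ :=
    fun l => match l with
    | 0 => W₀
    | 1 => W₁
    | _ + 2 => 0
  let b : (l : ℕ) → Fin (layerWidth d p (l + 1)) → ℝ := fun l => match l with
    | 0 => b₀
    | 1 => b₁
    | _ + 2 => 0
  refine ⟨R, p, fun r u => σ (ω r ⬝ᵥ layer σ W b u 2 + β r), α, ?_, ⟨W, b, ω, β, rfl⟩, ?_⟩
  · rintro (_ | l) <;> exact Nat.succ_pos _
  · intro i u hu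
    refine (h₂ i u hu).trans ?_
    linarith

theorem IsDeepsharedCovNet.isDeepCovNet {σ : ℝ → ℝ} {d : ℕ} {k : (Fin d → ℝ) → (Fin d → ℝ) → ℝ}
    (hk : IsDeepsharedCovNet σ k) : IsDeepCovNet σ k := by
  obtain ⟨R, L, p, hR, hL, hp, Λ, g, hΛ, ⟨W, b, ω, β, rfl⟩, rfl⟩ := hk
  exact ⟨R, L, p, hR, hL, hp, Λ, _, hΛ, fun r => ⟨W, b, ω r, β r, rfl⟩, rfl⟩

/-- Linear substitution in both arguments of a bilinear map conjugates the coefficient matrix. It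
serves for products of networks and for changes of basis in tensors; in both, conjugation preserves
positive semi-definiteness. -/
theorem sum_conj_bilin {m n : ℕ} {V V' G : Type*} [AddCommGroup V] [Module ℝ V]
    [AddCommGroup V'] [Module ℝ V'] [AddCommGroup G] [Module ℝ G] (T : V →ₗ[ℝ] V' →ₗ[ℝ] G)
    (A : Matrix (Fin m) (Fin n) ℝ) (N : Matrix (Fin m) (Fin m) ℝ) (x : Fin n → V)
    (y : Fin n → V') :
    ∑ r, ∑ s, (Aᴴ * N * A) r s • T (x r) (y s) =
      ∑ i, ∑ j, N i j • T (∑ r, A i r • x r) (∑ s, A j s • y s) := by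
  have h1 : ∀ r s, (Aᴴ * N * A) r s • T (x r) (y s) =
      ∑ i, ∑ j, N i j • A i r • A j s • T (x r) (y s) := by
    intro r s
    simp only [Matrix.mul_apply, Finset.sum_mul, conjTranspose_apply, star_trivial,
      Finset.sum_smul, smul_smul]
    rw [Finset.sum_comm]
    exact Finset.sum_congr rfl fun i _ => Finset.sum_congr rfl fun j _ => by congr 1; ring
  simp only [h1, map_sum, map_smul, LinearMap.sum_apply, LinearMap.smul_apply, Finset.smul_sum]
  rw [Finset.sum_congr rfl fun r _ => Finset.sum_comm, Finset.sum_comm]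
  refine Finset.sum_congr rfl fun i _ => ?_
  rw [Finset.sum_congr rfl fun r _ => Finset.sum_comm, Finset.sum_comm]
  refine Finset.sum_congr rfl fun j _ => ?_
  rw [Finset.sum_comm]
  exact Finset.sum_congr rfl fun r _ => Finset.sum_congr rfl fun s _ => by
    rw [smul_comm (A i _) (A j _)]

/-- Kernels `∑ N i j ψ i (u) ψ j (v)` with `N` positive semi-definite and `ψ i` continuous are
uniformly approximated by deepshared CovNet kernels. -/
theorem Sigmoidal.exists_deepshared {σ : ℝ → ℝ} (hσ : Sigmoidal σ) {d m : ℕ}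
    {Q : Set (Fin d → ℝ)} (hQ : IsCompact Q) (ψ : Fin m → (Fin d → ℝ) → ℝ)
    (hψ : ∀ i, Continuous (ψ i)) {N : Matrix (Fin m) (Fin m) ℝ} (hN : N.PosSemidef)
    {ε : ℝ} (hε : 0 < ε) :
    ∃ k, IsDeepsharedCovNet σ k ∧ UniformlyClose Q (covNetKernel N ψ) k ε := by
  choose B hB using fun i => hQ.exists_bound_of_continuousOn (hψ i).continuousOn
  obtain ⟨K, hK0, hK⟩ : ∃ K : ℝ, 0 ≤ K ∧ ∀ i, ∀ u ∈ Q, |ψ i u| ≤ K :=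
    ⟨∑ i, |B i|, by positivity, fun i u hu => ((hB i u hu).trans (le_abs_self _)).trans
      (Finset.single_le_sum (fun j _ => abs_nonneg (B j)) (Finset.mem_univ i))⟩
  let S : ℝ := ∑ i, ∑ j, |N i j|
  have hS : 0 ≤ S := by positivity
  -- Each product ψ i (u) ψ j (v) is off by at most K η + η (K + 1); the second factor uses η ≤ 1.
  let η : ℝ := min 1 (ε / ((S + 1) * (2 * K + 1)))
  have hη : 0 < η := by positivity
  have hη1 : η ≤ 1 := min_le_left _ _
  have hηε : S * (η * (2 * K + 1)) ≤ ε := by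
    have h1 : η ≤ ε / ((S + 1) * (2 * K + 1)) := min_le_right _ _
    rw [le_div_iff₀ (by positivity)] at h1
    nlinarith [mul_nonneg hη.le (by positivity : (0 : ℝ) ≤ 2 * K + 1)]
  obtain ⟨R, p, g, α, hp, hg, hα⟩ := hσ.exists_sharedDeepNets hQ ψ hψ hη
  let A : Matrix (Fin m) (Fin (R + 1)) ℝ := Matrix.of α
  refine ⟨covNetKernel (Aᴴ * N * A) g, ⟨R + 1, 2, p, R.succ_pos, one_lt_two, fun l _ => hp l,
    _, g, hN.conjTranspose_mul_mul_same A, hg, rfl⟩, fun u hu v hv => ?_⟩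
  have hexp : covNetKernel (Aᴴ * N * A) g u v =
      ∑ i, ∑ j, N i j * (∑ r, α i r * g r u) * (∑ s, α j s * g s v) := by
    have h := sum_conj_bilin (LinearMap.mul ℝ ℝ) A N (fun r => g r u) fun s => g s v
    simp only [LinearMap.mul_apply', smul_eq_mul, ← mul_assoc] at h
    exact h
  rw [hexp, covNetKernel, ← Finset.sum_sub_distrib]
  refine le_trans ?_ hηε
  rw [Finset.sum_mul]
  refine (Finset.abs_sum_le_sum_abs _ _).trans (Finset.sum_le_sum fun i _ => ?_)
  rw [← Finset.sum_sub_distrib, Finset.sum_mul]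
  refine (Finset.abs_sum_le_sum_abs _ _).trans (Finset.sum_le_sum fun j _ => ?_)
  have hi := hα i u hu
  have hj := hα j v hv
  set x := ∑ r, α i r * g r u
  set y := ∑ s, α j s * g s v
  have hy : |y| ≤ K + 1 := by
    have := abs_sub_abs_le_abs_sub y (ψ j v)
    rw [abs_sub_comm] at this
    linarith [hK j v hv]
  rw [show N i j * ψ i u * ψ j v - N i j * x * y =
    N i j * (ψ i u * (ψ j v - y) + (ψ i u - x) * y) by ring, abs_mul]
  refine mul_le_mul_of_nonneg_left ((abs_add_le _ _).trans ?_) (abs_nonneg _)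
  rw [abs_mul, abs_mul]
  have h1 := mul_le_mul (hK i u hu) hj (abs_nonneg _) hK0
  have h2 := mul_le_mul hi hy (abs_nonneg _) hη.le
  linarith

/-! ### Projection onto tensors with positive semi-definite coefficients -/

/-- The Fourier coefficients give the best approximation by an orthonormal family. -/
theorem norm_sub_sum_inner_le {ι G : Type*} [Fintype ι] [NormedAddCommGroup G]
    [InnerProductSpace ℝ G] {E : ι → G} (hE : Orthonormal ℝ E) (y : G) (a : ι → ℝ) :
    ‖y - ∑ i, inner ℝ (E i) y • E i‖ ≤ ‖y - ∑ i, a i • E i‖ := by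
  set z := y - ∑ i, inner ℝ (E i) y • E i with hz
  have hzE : ∀ i, inner ℝ z (E i) = 0 := fun i => by
    rw [hz, inner_sub_left, real_inner_comm, real_inner_comm (E i) (∑ i, _),
      hE.inner_right_fintype, sub_self]
  have h : y - ∑ i, a i • E i = z + ∑ i, (inner ℝ (E i) y - a i) • E i := by
    simp only [hz, sub_smul, Finset.sum_sub_distrib]
    abel
  have h0 : inner ℝ z (∑ i, (inner ℝ (E i) y - a i) • E i) = 0 := by
    simp [inner_sum, inner_smul_right, hzE]
  rw [h]
  refine le_of_sq_le_sq ?_ (norm_nonneg _)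
  rw [norm_add_sq_real, h0]
  nlinarith [sq_nonneg ‖∑ i, (inner ℝ (E i) y - a i) • E i‖]

/-- If the bilinear form `⟪y, T f g⟫` is symmetric and non-negative, where `T` is a Hilbert tensor
product map, then `y` is approximated at least as well by a tensor with positive semi-definite
coefficients as by any other tensor on the same vectors. -/
theorem exists_posSemidef_norm_sub_le {H G : Type*} [NormedAddCommGroup H] [InnerProductSpace ℝ H]
    [NormedAddCommGroup G] [InnerProductSpace ℝ G] (T : H →ₗ[ℝ] H →ₗ[ℝ] G)
    (hT : ∀ f g f' g', inner ℝ (T f g) (T f' g') = inner ℝ f f' * inner ℝ g g') (y : G)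
    (hy : ∀ f g, inner ℝ (T f g) y = inner ℝ (T g f) y) (hy0 : ∀ f, 0 ≤ inner ℝ (T f f) y)
    {n : ℕ} (ψ : Fin n → H) (a : Matrix (Fin n) (Fin n) ℝ) :
    ∃ N : Matrix (Fin n) (Fin n) ℝ, N.PosSemidef ∧
      ‖y - ∑ k, ∑ l, N k l • T (ψ k) (ψ l)‖ ≤ ‖y - ∑ k, ∑ l, a k l • T (ψ k) (ψ l)‖ := by
  let V : Submodule ℝ H := Submodule.span ℝ (Set.range ψ)
  have : FiniteDimensional ℝ V := FiniteDimensional.span_of_finite ℝ (Set.finite_range ψ)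
  let e := stdOrthonormalBasis ℝ V
  have heo : Orthonormal ℝ fun i => (e i : H) :=
    e.orthonormal.comp_linearIsometry V.subtypeₗᵢ
  choose B hB using fun i => (Submodule.mem_span_range_iff_exists_fun ℝ).1 (e i).2
  -- The Fourier coefficients of `y` in the orthonormal family T (e i) (e j); their quadratic form
  -- at `x` is the form of `hy0` at ∑ x i e i.
  let M : Matrix _ _ ℝ := Matrix.of fun i j => inner ℝ (T (e i) (e j)) y
  have hM : M.PosSemidef := by
    refine .of_dotProduct_mulVec_nonneg (Matrix.IsHermitian.ext fun i j => hy _ _) fun x => ?_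
    refine (hy0 (∑ i, x i • (e i : H))).trans_eq ?_
    simp only [map_sum, map_smul, LinearMap.sum_apply, LinearMap.smul_apply, sum_inner,
      inner_smul_left, star_trivial, dotProduct, mulVec, Finset.mul_sum, M, Matrix.of_apply,
      conj_trivial]
    rw [Finset.sum_comm]
    exact Finset.sum_congr rfl fun i _ => Finset.sum_congr rfl fun j _ => by ring
  let A : Matrix (Fin n) _ ℝ := Matrix.of fun k i =>
    inner ℝ (e i : H) (ψ k)
  have hA : ∀ k, ψ k = ∑ i, A k i • (e i : H) := fun k => by
    have := congrArg (V.subtype) (e.sum_repr' ⟨ψ k, Submodule.subset_span ⟨k, rfl⟩⟩)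
    simpa [A] using this.symm
  have hE : Orthonormal ℝ fun q : Fin _ × Fin _ => T (e q.1) (e q.2) := by
    classical
    rw [orthonormal_iff_ite] at heo ⊢
    rintro ⟨i, j⟩ ⟨i', j'⟩
    rw [hT, heo, heo]
    by_cases h1 : i = i' <;> by_cases h2 : j = j' <;> simp [h1, h2]
  -- `B` rewrites the projection in terms of ψ; `A` conversely turns the competitor `a` into a
  -- combination of the T (e i) (e j).
  refine ⟨(Matrix.of B)ᴴ * M * Matrix.of B, hM.conjTranspose_mul_mul_same _, ?_⟩
  have h := norm_sub_sum_inner_le hE y fun q => (Aᴴ * a * A) q.1 q.2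
  simp only [Fintype.sum_prod_type] at h
  rw [sum_conj_bilin] at h ⊢
  simp only [Matrix.of_apply, hB, ← hA] at h ⊢
  exact h

/-! ### The tensor product on L² -/

theorem memLp_tensor {d : ℕ} {μ : Measure (Fin d → ℝ)} [SFinite μ] {f g : (Fin d → ℝ) → ℝ} (hf : MemLp f 2 μ) (hg : MemLp g 2 μ) :
    MemLp (fun z : (Fin d → ℝ) × (Fin d → ℝ) => f z.1 * g z.2) 2 (μ.prod μ) := by
  refine (memLp_two_iff_integrable_sq (hf.1.comp_fst.mul hg.1.comp_snd)).2 ?_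
  convert hf.integrable_sq.mul_prod hg.integrable_sq using 2 with z
  exact mul_pow _ _ _

section Tensor

variable {d : ℕ} {μ : Measure (Fin d → ℝ)} [IsFiniteMeasure μ]

/-- The tensor product map `(f, g) ↦ f(u) g(v)` from `L²(μ)` to `L²(μ ⊗ μ)`. -/
def tensor (μ : Measure (Fin d → ℝ)) [IsFiniteMeasure μ] :
    Lp ℝ 2 μ →ₗ[ℝ] Lp ℝ 2 μ →ₗ[ℝ] Lp ℝ 2 (μ.prod μ) :=
  LinearMap.mk₂ ℝ (fun f g => (memLp_tensor (Lp.memLp f) (Lp.memLp g)).toLp)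
    (fun f f' g => by
      rw [← MemLp.toLp_add]
      refine MemLp.toLp_congr _ _ ?_
      filter_upwards [Measure.quasiMeasurePreserving_fst.ae_eq (Lp.coeFn_add f f')] with z hz
      simp only [Function.comp_apply, Pi.add_apply] at hz ⊢
      rw [hz, add_mul])
    (fun a f g => by
      rw [← MemLp.toLp_const_smul]
      refine MemLp.toLp_congr _ _ ?_
      filter_upwards [Measure.quasiMeasurePreserving_fst.ae_eq (Lp.coeFn_smul a f)] with z hz
      simp only [Function.comp_apply, Pi.smul_apply, smul_eq_mul] at hz ⊢
      rw [hz, mul_assoc])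
    (fun f g g' => by
      rw [← MemLp.toLp_add]
      refine MemLp.toLp_congr _ _ ?_
      filter_upwards [Measure.quasiMeasurePreserving_snd.ae_eq (Lp.coeFn_add g g')] with z hz
      simp only [Function.comp_apply, Pi.add_apply] at hz ⊢
      rw [hz, mul_add])
    (fun a f g => by
      rw [← MemLp.toLp_const_smul]
      refine MemLp.toLp_congr _ _ ?_
      filter_upwards [Measure.quasiMeasurePreserving_snd.ae_eq (Lp.coeFn_smul a g)] with z hz
      simp only [Function.comp_apply, Pi.smul_apply, smul_eq_mul] at hz ⊢
      rw [hz, mul_left_comm])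

theorem tensor_toLp {f g : (Fin d → ℝ) → ℝ} (hf : MemLp f 2 μ) (hg : MemLp g 2 μ) :
    tensor μ hf.toLp hg.toLp = (memLp_tensor hf hg).toLp := by
  refine MemLp.toLp_congr (memLp_tensor (Lp.memLp _) (Lp.memLp _)) _ ?_
  filter_upwards [Measure.quasiMeasurePreserving_fst.ae_eq hf.coeFn_toLp,
    Measure.quasiMeasurePreserving_snd.ae_eq hg.coeFn_toLp] with z h1 h2
  simp only [Function.comp_apply] at h1 h2
  rw [h1, h2]

theorem tensor_ae (f g : Lp ℝ 2 μ) :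
    tensor μ f g =ᵐ[μ.prod μ] fun z => f z.1 * g z.2 :=
  (memLp_tensor (Lp.memLp f) (Lp.memLp g)).coeFn_toLp

theorem inner_tensor (f g f' g' : Lp ℝ 2 μ) :
    inner ℝ (tensor μ f g) (tensor μ f' g') = inner ℝ f f' * inner ℝ g g' := by
  simp only [L2.inner_def, RCLike.inner_apply, conj_trivial]
  rw [← integral_prod_mul]
  refine integral_congr_ae ?_
  filter_upwards [tensor_ae f g, tensor_ae f' g'] with z h1 h2
  rw [h1, h2]
  ring

/-- `⟪f ⊗ g, c⟫ = ⟪f, C g⟫` when `c` is the kernel of `C`. -/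
theorem inner_tensor_kernel {c : (Fin d → ℝ) → (Fin d → ℝ) → ℝ} {C : Lp ℝ 2 μ →L[ℝ] Lp ℝ 2 μ}
    (hc : MemLp (fun z : (Fin d → ℝ) × (Fin d → ℝ) => c z.1 z.2) 2 (μ.prod μ))
    (hC : ∀ f : Lp ℝ 2 μ, ∀ᵐ u ∂μ, C f u = ∫ v, c u v * f v ∂μ) (f g : Lp ℝ 2 μ) :
    inner ℝ (tensor μ f g) hc.toLp = inner ℝ f (C g) := by
  simp only [L2.inner_def, RCLike.inner_apply, conj_trivial]
  have h1 : ∫ z, (hc.toLp : Lp ℝ 2 (μ.prod μ)) z * tensor μ f g z ∂(μ.prod μ) =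
      ∫ z, c z.1 z.2 * (f z.1 * g z.2) ∂(μ.prod μ) := by
    refine integral_congr_ae ?_
    filter_upwards [tensor_ae f g, hc.coeFn_toLp] with z h1 h2
    rw [h1, h2]
  have h2 : Integrable (fun z : (Fin d → ℝ) × (Fin d → ℝ) => c z.1 z.2 * (f z.1 * g z.2))
      (μ.prod μ) := hc.integrable_mul (memLp_tensor (Lp.memLp f) (Lp.memLp g))
  rw [h1, integral_prod _ h2]
  refine integral_congr_ae ?_
  filter_upwards [hC g] with u hu
  rw [hu, ← integral_mul_const]
  exact integral_congr_ae (Eventually.of_forall fun v => by ring)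

end Tensor

theorem norm_toLp_sq {α : Type*} [MeasurableSpace α] {μ : Measure α} {f : α → ℝ}
    (hf : MemLp f 2 μ) : ‖hf.toLp‖ ^ 2 = ∫ z, |f z| ^ 2 ∂μ := by
  rw [← real_inner_self_eq_norm_sq, L2.inner_def]
  refine integral_congr_ae ?_
  filter_upwards [hf.coeFn_toLp] with z hz
  simp only [RCLike.inner_apply, conj_trivial]
  rw [hz, sq_abs, sq]

/-! ### Covariance operators -/

section Covariance

variable {H Ω : Type*} [NormedAddCommGroup H] [InnerProductSpace ℝ H] [CompleteSpace H]
  [MeasurableSpace Ω] {P : Measure Ω} [IsProbabilityMeasure P] {X : Ω → H}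

/-- The inner product passes under the Bochner integral, as the rank-one integrand has norm ‖Y‖²,
which is integrable. Symmetry and non-negativity can be read off the result. -/
theorem inner_covOperator (hX : MemLp X 2 P) (f g : H) :
    inner ℝ f (covOperator P X g) =
      ∫ ω, inner ℝ (X ω - ∫ ω', X ω' ∂P) f * inner ℝ (X ω - ∫ ω', X ω' ∂P) g ∂P := by
  have hY : MemLp (fun ω => X ω - ∫ ω', X ω' ∂P) 2 P := hX.sub (memLp_const _)
  set Y : Ω → H := fun ω => X ω - ∫ ω', X ω' ∂P
  have hcont : Continuous fun y : H => InnerProductSpace.rankOne ℝ y y :=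
    (InnerProductSpace.rankOne ℝ : H →L[ℝ] H →L⋆[ℝ] H →L[ℝ] H).continuous₂.comp (continuous_id.prodMk continuous_id)
  have hint : Integrable (fun ω => InnerProductSpace.rankOne ℝ (Y ω) (Y ω)) P := by
    refine (hY.integrable_norm_pow two_ne_zero).mono'
      (hcont.comp_aestronglyMeasurable hY.1) (Eventually.of_forall fun ω => ?_)
    rw [InnerProductSpace.norm_rankOne, sq]
  change inner ℝ f ((∫ ω, InnerProductSpace.rankOne ℝ (Y ω) (Y ω) ∂P) g) = _
  rw [ContinuousLinearMap.integral_apply hint, ← integral_inner (hint.apply_continuousLinearMap g)]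
  refine integral_congr_ae (Eventually.of_forall fun ω => ?_)
  simp only [InnerProductSpace.rankOne_apply, inner_smul_right]
  rw [real_inner_comm f, mul_comm]

theorem inner_covOperator_comm (hX : MemLp X 2 P) (f g : H) :
    inner ℝ f (covOperator P X g) = inner ℝ g (covOperator P X f) := by
  simp only [inner_covOperator hX, mul_comm]

theorem inner_covOperator_self_nonneg (hX : MemLp X 2 P) (f : H) :
    0 ≤ inner ℝ f (covOperator P X f) := by
  rw [inner_covOperator hX]
  exact integral_nonneg fun ω => mul_self_nonneg _

end Covariance

/-! ### Sampling and limits of positive semi-definite matrices -/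

/-- A continuous kernel is uniformly approximated by its samples, interpolated with a partition
of unity. -/
theorem exists_sampling {d : ℕ} {Q : Set (Fin d → ℝ)} (hQ : IsCompact Q)
    {k : (Fin d → ℝ) → (Fin d → ℝ) → ℝ}
    (hk : ContinuousOn (fun z : (Fin d → ℝ) × (Fin d → ℝ) => k z.1 z.2) (Q ×ˢ Q))
    {ε : ℝ} (hε : 0 < ε) :
    ∃ (n : ℕ) (x : Fin n → Fin d → ℝ) (ψ : Fin n → (Fin d → ℝ) → ℝ), (∀ i, x i ∈ Q) ∧
      (∀ i, Continuous (ψ i)) ∧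
      UniformlyClose Q k (covNetKernel (Matrix.of fun i j => k (x i) (x j)) ψ) ε := by
  obtain ⟨δ, hδ, hδε⟩ := Metric.uniformContinuousOn_iff.1
    ((hQ.prod hQ).uniformContinuousOn_of_continuous hk) ε hε
  obtain ⟨t, htQ, ht, hcov⟩ := hQ.finite_cover_balls hδ
  obtain ⟨n, x, -, rfl⟩ := ht.fin_param
  obtain ⟨ρ, hρ⟩ := PartitionOfUnity.exists_isSubordinate hQ.isClosed
    (fun i => Metric.ball (x i) δ) (fun _ => Metric.isOpen_ball) (by simpa using hcov)
  have hx : ∀ i, x i ∈ Q := fun i => htQ ⟨i, rfl⟩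
  refine ⟨n, x, fun i => ρ i, hx, fun i => (ρ i).continuous, fun u hu v hv => ?_⟩
  have hsum : ∀ u ∈ Q, ∑ i, ρ i u = 1 := fun u hu => by
    rw [← finsum_eq_sum_of_fintype]; exact ρ.sum_eq_one hu
  have hnear : ∀ i u, ρ i u ≠ 0 → dist u (x i) < δ := fun i u h =>
    hρ i (subset_tsupport _ h)
  have h1 : k u v = ∑ i, ∑ j, k u v * ρ i u * ρ j v := by
    simp only [mul_assoc, ← Finset.mul_sum, hsum v hv, mul_one, hsum u hu]
  -- Writing ε as a weighted average too reduces the bound to single pairs (i, j), where only those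
  -- with `u` near x i and `v` near x j have weight.
  have h2 : ε = ∑ i, ∑ j, ε * (ρ i u * ρ j v) := by
    simp only [← Finset.mul_sum, hsum v hv, mul_one, hsum u hu]
  rw [covNetKernel]
  nth_rewrite 1 [h1]
  rw [h2, ← Finset.sum_sub_distrib]
  refine (Finset.abs_sum_le_sum_abs _ _).trans (Finset.sum_le_sum fun i _ => ?_)
  rw [← Finset.sum_sub_distrib]
  refine (Finset.abs_sum_le_sum_abs _ _).trans (Finset.sum_le_sum fun j _ => ?_)
  rw [Matrix.of_apply, mul_assoc, mul_assoc, ← sub_mul, abs_mul,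
    abs_of_nonneg (mul_nonneg (ρ.nonneg i u) (ρ.nonneg j v))]
  by_cases h : ρ i u * ρ j v = 0
  · simp [h]
  · refine mul_le_mul_of_nonneg_right ?_ (mul_nonneg (ρ.nonneg i u) (ρ.nonneg j v))
    have := hδε (u, v) ⟨hu, hv⟩ (x i, x j) ⟨hx i, hx j⟩
      (max_lt (hnear i u (left_ne_zero_of_mul h)) (hnear j v (right_ne_zero_of_mul h)))
    rw [Real.dist_eq] at this
    exact this.le

/-- A matrix that is an entrywise limit of positive semi-definite matrices is positive
semi-definite. -/
theorem posSemidef_of_forall_close {n : ℕ} {K : Matrix (Fin n) (Fin n) ℝ}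
    (h : ∀ ε : ℝ, 0 < ε → ∃ M : Matrix (Fin n) (Fin n) ℝ, M.PosSemidef ∧
      ∀ i j, |M i j - K i j| ≤ ε) : K.PosSemidef := by
  refine .of_dotProduct_mulVec_nonneg (Matrix.IsHermitian.ext fun i j => ?_) fun x => ?_
  · rw [star_trivial]
    refine eq_of_forall_dist_le fun ε hε => ?_
    obtain ⟨M, hM, hMK⟩ := h (ε / 2) (half_pos hε)
    have h1 := abs_le.1 (hMK i j)
    have h2 := abs_le.1 (hMK j i)
    have h3 := hM.1.apply i j
    rw [star_trivial] at h3
    rw [Real.dist_eq]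
    exact abs_le.2 ⟨by linarith, by linarith⟩
  · let S : ℝ := ∑ i, ∑ j, |x i| * |x j|
    have hS : 0 ≤ S := by positivity
    refine le_of_forall_pos_le_add fun ε hε => ?_
    obtain ⟨M, hM, hMK⟩ := h (ε / (S + 1)) (by positivity)
    have h1 := hM.dotProduct_mulVec_nonneg x
    have h2 : star x ⬝ᵥ (M *ᵥ x) - star x ⬝ᵥ (K *ᵥ x) ≤ ε / (S + 1) * S := by
      simp only [dotProduct, mulVec, Finset.mul_sum, ← Finset.sum_sub_distrib, S]
      refine Finset.sum_le_sum fun i _ => Finset.sum_le_sum fun j _ => ?_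
      rw [show star x i * (M i j * x j) - star x i * (K i j * x j) =
        (M i j - K i j) * (x i * x j) by simp; ring, ← abs_mul]
      refine (le_abs_self _).trans ?_
      rw [abs_mul]
      exact mul_le_mul_of_nonneg_right (hMK i j) (abs_nonneg _)
    have h3 : ε / (S + 1) * S ≤ ε := by
      rw [div_mul_eq_mul_div, div_le_iff₀ (by positivity)]
      nlinarith
    linarith

theorem isFiniteMeasure_of_isCompact {d : ℕ} {Q : Set (Fin d → ℝ)} (hQ : IsCompact Q) :
    IsFiniteMeasure ((volume : Measure (Fin d → ℝ)).restrict Q) :=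
  MeasureTheory.isFiniteMeasure_restrict.2 hQ.measure_lt_top.ne

theorem restrict_prod_eq {d : ℕ} (Q : Set (Fin d → ℝ)) :
    (volume : Measure ((Fin d → ℝ) × (Fin d → ℝ))).restrict (Q ×ˢ Q) =
      ((volume : Measure (Fin d → ℝ)).restrict Q).prod (volume.restrict Q) := by
  rw [Measure.volume_eq_prod, Measure.prod_restrict]

/-! ### Kernels of covariance operators -/

section Kernel

variable {d : ℕ} {Q : Set (Fin d → ℝ)} {Ω : Type*} [MeasurableSpace Ω] {P : Measure Ω}
  [IsProbabilityMeasure P] {X : Ω → L2 Q} {c : (Fin d → ℝ) → (Fin d → ℝ) → ℝ}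

theorem IsKernelOf.memLp_prod {C : L2 Q →L[ℝ] L2 Q} (hc : IsKernelOf Q c C) :
    MemLp (fun z : (Fin d → ℝ) × (Fin d → ℝ) => c z.1 z.2) 2
      (((volume : Measure (Fin d → ℝ)).restrict Q).prod (volume.restrict Q)) :=
  restrict_prod_eq Q ▸ hc.memLp

/-- A continuous kernel of a covariance operator is non-negative definite at all points, if all
non-empty relatively open sets have positive measure. -/
theorem HasFullSupport.nonnegDefOn (hQ : IsCompact Q) (hX : MemLp X 2 P)
    (hc : IsKernelOf Q c (covOperator P X)) (hs : HasFullSupport Q)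
    (hcont : ContinuousOn (fun z : (Fin d → ℝ) × (Fin d → ℝ) => c z.1 z.2) (Q ×ˢ Q)) :
    NonnegDefOn Q c := by
  have := isFiniteMeasure_of_isCompact hQ
  intro n x hx
  refine posSemidef_of_forall_close fun ε hε => ?_
  obtain ⟨δ, hδ, hδε⟩ := Metric.uniformContinuousOn_iff.1
    ((hQ.prod hQ).uniformContinuousOn_of_continuous hcont) ε hε
  set μ : Measure (Fin d → ℝ) := volume.restrict Q with hμ
  let a : Fin n → ℝ := fun i => μ.real (Metric.ball (x i) δ)
  have ha : ∀ i, 0 < a i := fun i => by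
    refine ENNReal.toReal_pos ?_ (measure_ne_top _ _)
    rw [hμ, Measure.restrict_apply Metric.isOpen_ball.measurableSet, Set.inter_comm]
    exact (hs _ Metric.isOpen_ball ⟨x i, hx i, Metric.mem_ball_self hδ⟩).ne'
  -- Normalised indicators of small balls: the covariance form on them averages `c` near (x i, x j).
  -- Full support makes the normalisation possible.
  let f : Fin n → (Fin d → ℝ) → ℝ := fun i =>
    (Metric.ball (x i) δ).indicator fun _ => (a i)⁻¹
  have hf0 : ∀ i u, 0 ≤ f i u := fun i u =>
    Set.indicator_nonneg (fun _ _ => (inv_pos.2 (ha i)).le) u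
  have hf : ∀ i, MemLp (f i) 2 μ := fun i =>
    (memLp_const _).indicator Metric.isOpen_ball.measurableSet
  have hf1 : ∀ i, ∫ u, f i u ∂μ = 1 := fun i => by
    simp only [f]
    rw [integral_indicator_const _ Metric.isOpen_ball.measurableSet, smul_eq_mul]
    exact mul_inv_cancel₀ (ha i).ne'
  let F : Fin n → L2 Q := fun i => (hf i).toLp
  refine ⟨Matrix.of fun i j => inner ℝ (F i) (covOperator P X (F j)), ?_, fun i j => ?_⟩
  · refine .of_dotProduct_mulVec_nonneg
      (Matrix.IsHermitian.ext fun i j => inner_covOperator_comm hX _ _) fun y => ?_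
    refine (inner_covOperator_self_nonneg hX (∑ i, y i • F i)).trans_eq ?_
    simp only [map_sum, map_smul, sum_inner, inner_sum, inner_smul_left, inner_smul_right,
      star_trivial, dotProduct, mulVec, Finset.mul_sum, Matrix.of_apply, conj_trivial]
    rw [Finset.sum_comm]
    exact Finset.sum_congr rfl fun i _ => Finset.sum_congr rfl fun j _ => by ring
  · have hten := memLp_tensor (hf i) (hf j)
    have hint : Integrable (fun z : (Fin d → ℝ) × (Fin d → ℝ) => f i z.1 * f j z.2)
        (μ.prod μ) := hten.integrable one_le_two
    have h1 : inner ℝ (F i) (covOperator P X (F j)) =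
        ∫ z, c z.1 z.2 * (f i z.1 * f j z.2) ∂(μ.prod μ) := by
      rw [← inner_tensor_kernel hc.memLp_prod hc.apply_ae, tensor_toLp, L2.inner_def]
      refine integral_congr_ae ?_
      filter_upwards [hten.coeFn_toLp, hc.memLp_prod.coeFn_toLp] with z h1 h2
      simp only [RCLike.inner_apply, conj_trivial]
      rw [h1, h2]
    have h2 : ∫ z, f i z.1 * f j z.2 ∂(μ.prod μ) = 1 := by
      rw [integral_prod_mul, hf1, hf1, one_mul]
    have h3 : Integrable (fun z : (Fin d → ℝ) × (Fin d → ℝ) => c z.1 z.2 * (f i z.1 * f j z.2))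
        (μ.prod μ) := hc.memLp_prod.integrable_mul hten
    rw [Matrix.of_apply, Matrix.of_apply, h1]
    have h4 : (∫ z, c z.1 z.2 * (f i z.1 * f j z.2) ∂(μ.prod μ)) - c (x i) (x j) =
        ∫ z, (c z.1 z.2 - c (x i) (x j)) * (f i z.1 * f j z.2) ∂(μ.prod μ) := by
      simp only [sub_mul]
      rw [integral_sub h3 (hint.const_mul _), integral_const_mul, h2, mul_one]
    have h5 : ε = ∫ z, ε * (f i z.1 * f j z.2) ∂(μ.prod μ) := by
      rw [integral_const_mul, h2, mul_one]
    rw [h4, h5, ← Real.norm_eq_abs]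
    refine norm_integral_le_of_norm_le (hint.const_mul _) ?_
    rw [hμ, ← restrict_prod_eq, ae_restrict_iff' (hQ.prod hQ).measurableSet]
    refine Eventually.of_forall fun z hz => ?_
    rw [Real.norm_eq_abs, abs_mul, abs_of_nonneg (mul_nonneg (hf0 _ _) (hf0 _ _))]
    by_cases h : f i z.1 * f j z.2 = 0
    · simp [h]
    · have hi : z.1 ∈ Metric.ball (x i) δ :=
        Set.mem_of_indicator_ne_zero (left_ne_zero_of_mul h)
      have hj : z.2 ∈ Metric.ball (x j) δ :=
        Set.mem_of_indicator_ne_zero (right_ne_zero_of_mul h)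
      refine mul_le_mul_of_nonneg_right ?_ (mul_nonneg (hf0 _ _) (hf0 _ _))
      have := hδε z hz (x i, x j) ⟨hx i, hx j⟩
        (max_lt hi hj)
      rw [Real.dist_eq] at this
      exact this.le

/-- Q × Q has measure vol(Q)², whose square root is the factor. -/
theorem norm_toLp_le_of_forall_abs_le (hQ : IsCompact Q) {η : ℝ} (hη : 0 ≤ η)
    {f : (Fin d → ℝ) × (Fin d → ℝ) → ℝ}
    (hf : MemLp f 2 (((volume : Measure (Fin d → ℝ)).restrict Q).prod (volume.restrict Q)))
    (h : ∀ u ∈ Q, ∀ v ∈ Q, |f (u, v)| ≤ η) :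
    ‖hf.toLp‖ ≤ (volume : Measure (Fin d → ℝ)).real Q * η := by
  have := isFiniteMeasure_of_isCompact hQ
  refine le_of_sq_le_sq ?_ (by positivity)
  rw [norm_toLp_sq]
  have hle : ∫ z, |f z| ^ 2 ∂(((volume : Measure (Fin d → ℝ)).restrict Q).prod (volume.restrict Q))
      ≤ ∫ _, η ^ 2 ∂(((volume : Measure (Fin d → ℝ)).restrict Q).prod (volume.restrict Q)) := by
    refine integral_mono_of_nonneg (Eventually.of_forall fun z => sq_nonneg _)
      (integrable_const _) ?_
    rw [← restrict_prod_eq]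
    refine (ae_restrict_iff' (hQ.prod hQ).measurableSet).2 (Eventually.of_forall fun z hz => ?_)
    exact pow_le_pow_left₀ (abs_nonneg _) (h _ hz.1 _ hz.2) 2
  refine hle.trans_eq ?_
  rw [integral_const, smul_eq_mul, ← Set.univ_prod_univ, measureReal_prod_prod,
    measureReal_restrict_apply_univ]
  ring

theorem memLp_covNetKernel {n : ℕ} {μ : Measure (Fin d → ℝ)} [SFinite μ]
    (N : Matrix (Fin n) (Fin n) ℝ) {ψ : Fin n → (Fin d → ℝ) → ℝ} (hψ : ∀ i, MemLp (ψ i) 2 μ) :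
    MemLp (fun z : (Fin d → ℝ) × (Fin d → ℝ) => covNetKernel N ψ z.1 z.2) 2 (μ.prod μ) := by
  simp only [covNetKernel, mul_assoc]
  exact memLp_finsetSum _ fun i _ => memLp_finsetSum _ fun j _ =>
    (memLp_tensor (hψ i) (hψ j)).const_mul _

theorem toLp_sum {α ι : Type*} [MeasurableSpace α] {μ : Measure α} (s : Finset ι) {f : ι → α → ℝ}
    (hf : ∀ i, MemLp (f i) 2 μ) :
    (memLp_finsetSum s fun i _ => hf i).toLp = ∑ i ∈ s, (hf i).toLp := by
  classical
  induction s using Finset.induction_on with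
  | empty =>
    simp only [Finset.sum_empty]
    exact MemLp.toLp_zero _
  | insert i s hi ih =>
    rw [Finset.sum_insert hi, ← ih, ← MemLp.toLp_add]
    exact MemLp.toLp_congr _ _ (Eventually.of_forall fun z => by simp [Finset.sum_insert hi])

theorem toLp_covNetKernel {n : ℕ} {μ : Measure (Fin d → ℝ)} [IsFiniteMeasure μ]
    (N : Matrix (Fin n) (Fin n) ℝ) {ψ : Fin n → (Fin d → ℝ) → ℝ} (hψ : ∀ i, MemLp (ψ i) 2 μ) :
    (memLp_covNetKernel N hψ).toLp =
      ∑ i, ∑ j, N i j • tensor μ (hψ i).toLp (hψ j).toLp := by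
  simp only [tensor_toLp, ← MemLp.toLp_const_smul]
  have h : ∀ i j, MemLp (N i j • fun z : (Fin d → ℝ) × (Fin d → ℝ) => ψ i z.1 * ψ j z.2) 2
      (μ.prod μ) := fun i j => (memLp_tensor (hψ i) (hψ j)).const_smul _
  rw [Finset.sum_congr rfl fun i _ => (toLp_sum Finset.univ (h i)).symm,
    ← toLp_sum Finset.univ fun i => memLp_finsetSum Finset.univ fun j _ => h i j]
  refine MemLp.toLp_congr _ _ (Eventually.of_forall fun z => ?_)
  simp [covNetKernel, mul_assoc]

/-- In `L²(Q × Q)`, the kernel of a covariance operator is a limit of finite-rank kernels with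
positive semi-definite coefficients and continuous factors. -/
theorem IsKernelOf.exists_posSemidef (hQ : IsCompact Q) (hX : MemLp X 2 P)
    (hc : IsKernelOf Q c (covOperator P X)) {ε : ℝ} (hε : 0 < ε) :
    ∃ (n : ℕ) (ψ : Fin n → (Fin d → ℝ) → ℝ) (N : Matrix (Fin n) (Fin n) ℝ)
      (hψ : ∀ i, MemLp (ψ i) 2 ((volume : Measure (Fin d → ℝ)).restrict Q)),
      (∀ i, Continuous (ψ i)) ∧ N.PosSemidef ∧
      ‖hc.memLp_prod.toLp - (memLp_covNetKernel N hψ).toLp‖ ≤ ε := by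
  have := isFiniteMeasure_of_isCompact hQ
  set μ : Measure (Fin d → ℝ) := volume.restrict Q with hμ
  obtain ⟨g, hg, hgm⟩ := hc.memLp_prod.exists_boundedContinuous_eLpNorm_sub_le
    ENNReal.ofNat_ne_top (ε := ENNReal.ofReal (ε / 2)) (by simpa using hε)
  -- A uniform error η costs at most vol(Q) η in L²; the `+ 1` covers null Q.
  let η : ℝ := ε / 2 / ((volume : Measure (Fin d → ℝ)).real Q + 1)
  have hη : 0 < η := by positivity
  obtain ⟨n, x, ψ, -, hψ, hclose⟩ := exists_sampling hQ (k := fun u v => g (u, v))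
    g.continuous.continuousOn hη
  have hψm : ∀ i, MemLp (ψ i) 2 μ := fun i => by
    obtain ⟨B, hB⟩ := hQ.exists_bound_of_continuousOn (hψ i).continuousOn
    refine MemLp.of_bound (hψ i).aestronglyMeasurable B ?_
    exact (ae_restrict_iff' hQ.measurableSet).2 (Eventually.of_forall hB)
  -- The sampled matrix of `g` need not be positive semi-definite; projecting `c` onto the same
  -- tensors repairs this without loss.
  obtain ⟨N, hN, hle⟩ := exists_posSemidef_norm_sub_le (tensor μ) inner_tensor
    hc.memLp_prod.toLp
    (fun f g => by
      rw [inner_tensor_kernel hc.memLp_prod hc.apply_ae,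
        inner_tensor_kernel hc.memLp_prod hc.apply_ae, inner_covOperator_comm hX])
    (fun f => by
      rw [inner_tensor_kernel hc.memLp_prod hc.apply_ae]
      exact inner_covOperator_self_nonneg hX f)
    (fun i => (hψm i).toLp) (Matrix.of fun i j => g (x i, x j))
  rw [← toLp_covNetKernel, ← toLp_covNetKernel] at hle
  refine ⟨n, ψ, N, hψm, hψ, hN, hle.trans ?_⟩
  have h1 : ‖hc.memLp_prod.toLp - hgm.toLp‖ ≤ ε / 2 := by
    rw [← MemLp.toLp_sub, Lp.norm_toLp]
    exact ENNReal.toReal_le_of_le_ofReal (half_pos hε).le hg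
  have h2 : ‖hgm.toLp - (memLp_covNetKernel (Matrix.of fun i j => g (x i, x j)) hψm).toLp‖ ≤
      ε / 2 := by
    rw [← MemLp.toLp_sub]
    refine (norm_toLp_le_of_forall_abs_le hQ hη.le _ fun u hu v hv => hclose u hu v hv).trans ?_
    simp only [η]
    rw [mul_div_assoc', div_le_iff₀ (by positivity)]
    linarith
  exact (norm_sub_le_norm_sub_add_norm_sub _ hgm.toLp _).trans (by linarith)

end Kernel

/-! ### Measurability and boundedness of networks -/

theorem Sigmoidal.measurable_layer {σ : ℝ → ℝ} (hσ : Sigmoidal σ) {d : ℕ} {p : ℕ → ℕ}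
    (W : (l : ℕ) → Matrix (Fin (layerWidth d p (l + 1))) (Fin (layerWidth d p l)) ℝ)
    (b : (l : ℕ) → Fin (layerWidth d p (l + 1)) → ℝ) (l : ℕ) :
    Measurable fun u => layer σ W b u l := by
  induction l with
  | zero => exact measurable_id
  | succ l ih =>
    -- σ may be discontinuous, but monotonicity makes it Borel.
    refine measurable_pi_lambda _ fun i => hσ.monotone.measurable.comp ?_
    simp only [mulVec, dotProduct]
    exact (Finset.measurable_sum _ fun j _ =>
      ((measurable_pi_apply j).comp ih).const_mul _).add_const _

theorem Sigmoidal.measurable_of_mem_sharedDeepNets {σ : ℝ → ℝ} (hσ : Sigmoidal σ) {d R L : ℕ}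
    {p : ℕ → ℕ} {g : Fin R → (Fin d → ℝ) → ℝ} (hg : g ∈ sharedDeepNets σ d R L p) (r : Fin R) :
    Measurable (g r) := by
  obtain ⟨W, b, ω, β, rfl⟩ := hg
  refine hσ.monotone.measurable.comp ?_
  simp only [dotProduct]
  exact (Finset.measurable_sum _ fun j _ =>
    ((measurable_pi_apply j).comp (hσ.measurable_layer W b L)).const_mul _).add_const _

theorem IsDeepsharedCovNet.memLp {σ : ℝ → ℝ} (hσ : Sigmoidal σ) {d : ℕ}
    {k : (Fin d → ℝ) → (Fin d → ℝ) → ℝ} (hk : IsDeepsharedCovNet σ k)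
    (μ : Measure (Fin d → ℝ)) [IsFiniteMeasure μ] :
    MemLp (fun z : (Fin d → ℝ) × (Fin d → ℝ) => k z.1 z.2) 2 (μ.prod μ) := by
  obtain ⟨R, L, p, -, -, -, Λ, g, -, hg, rfl⟩ := hk
  refine memLp_covNetKernel Λ fun r => MemLp.of_bound
    (hσ.measurable_of_mem_sharedDeepNets hg r).aestronglyMeasurable 1 ?_
  obtain ⟨W, b, ω, β, rfl⟩ := hg
  refine Eventually.of_forall fun u => ?_
  have h := hσ.mem_Icc (ω r ⬝ᵥ layer σ W b u L + β r)
  rw [Real.norm_eq_abs, abs_of_nonneg h.1]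
  exact h.2

end CovNet

end

theorem theorem2 {d : ℕ} (Q : Set (Fin d → ℝ)) (hQ : IsCompact Q)
    (σ : ℝ → ℝ) (hσ : CovNet.Sigmoidal σ)
    {Ω : Type*} [MeasurableSpace Ω] (P : Measure Ω) [IsProbabilityMeasure P]
    (X : Ω → CovNet.L2 Q) (hX : MemLp X 2 P)
    (c : (Fin d → ℝ) → (Fin d → ℝ) → ℝ)
    (hc : CovNet.IsKernelOf Q c (CovNet.covOperator P X)) :
    (∀ ε : ℝ, 0 < ε →
      (∃ k, CovNet.IsDeepCovNet σ k ∧ CovNet.L2Close Q c k ε) ∧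
      (∃ k, CovNet.IsDeepsharedCovNet σ k ∧ CovNet.L2Close Q c k ε)) ∧
    (ContinuousOn (fun z : (Fin d → ℝ) × (Fin d → ℝ) => c z.1 z.2) (Q ×ˢ Q) →
      (CovNet.NonnegDefOn Q c ∨ CovNet.HasFullSupport Q) →
      ∀ ε : ℝ, 0 < ε →
        (∃ k, CovNet.IsDeepCovNet σ k ∧ CovNet.UniformlyClose Q c k ε) ∧
        (∃ k, CovNet.IsDeepsharedCovNet σ k ∧ CovNet.UniformlyClose Q c k ε)) := by
  have := CovNet.isFiniteMeasure_of_isCompact hQ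
  refine ⟨fun ε hε => ?_, fun hcont hnn ε hε => ?_⟩
  -- `L2Close` bounds the squared norm, so the norm budget is √ε.
  · have hs : 0 < √ε := Real.sqrt_pos.2 hε
    obtain ⟨n, ψ, N, hψm, hψ, hN, hle⟩ := hc.exists_posSemidef hQ hX (half_pos hs)
    let η : ℝ := √ε / 2 / ((volume : Measure (Fin d → ℝ)).real Q + 1)
    have hη : 0 < η := by positivity
    obtain ⟨k, hk, hkη⟩ := hσ.exists_deepshared hQ ψ hψ hN hη
    suffices h : CovNet.L2Close Q c k ε from ⟨⟨k, hk.isDeepCovNet, h⟩, ⟨k, hk, h⟩⟩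
    have hkm := hk.memLp hσ (volume.restrict Q)
    have hdm := hc.memLp_prod.sub hkm
    have h2 : ‖(CovNet.memLp_covNetKernel N hψm).toLp - hkm.toLp‖ ≤ √ε / 2 := by
      rw [← MemLp.toLp_sub]
      refine (CovNet.norm_toLp_le_of_forall_abs_le hQ hη.le _
        fun u hu v hv => hkη u hu v hv).trans ?_
      simp only [η]
      rw [mul_div_assoc', div_le_iff₀ (by positivity)]
      linarith
    have h3 : ‖hdm.toLp‖ ≤ √ε := by
      rw [MemLp.toLp_sub hc.memLp_prod hkm]
      exact (norm_sub_le_norm_sub_add_norm_sub _ (CovNet.memLp_covNetKernel N hψm).toLp _).trans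
        (by linarith)
    have h4 := pow_le_pow_left₀ (norm_nonneg _) h3 2
    rw [CovNet.norm_toLp_sq, Real.sq_sqrt hε.le] at h4
    constructor
    · rw [IntegrableOn, CovNet.restrict_prod_eq]
      simp only [sq_abs]
      exact hdm.integrable_sq
    · rw [CovNet.restrict_prod_eq]
      exact h4
  · have hK : CovNet.NonnegDefOn Q c :=
      hnn.elim id fun hs => hs.nonnegDefOn hQ hX hc hcont
    obtain ⟨n, x, ψ, hx, hψ, hclose⟩ := CovNet.exists_sampling hQ hcont (half_pos hε)
    -- Non-negative definiteness at the nodes is exactly what makes the sampled coefficients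
    -- admissible.
    obtain ⟨k, hk, hkε⟩ := hσ.exists_deepshared hQ ψ hψ (hK n x hx) (half_pos hε)
    have h : CovNet.UniformlyClose Q c k ε := fun u hu v hv =>
      (abs_sub_le _ _ _).trans ((add_le_add (hclose u hu v hv) (hkε u hu v hv)).trans_eq
        (add_halves ε))
    exact ⟨⟨k, hk.isDeepCovNet, h⟩, ⟨k, hk, h⟩⟩
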